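/- Let $\mathbb X$ be a complex Banach space, let $A$ be a closed linear operator in $\mathbb X$ with domain $D(A)\subset\mathbb X$, let $B:\mathbb R\to L(\mathbb X)$ be of bounded variation (for the operator norm) with $$\int_{-\infty}^{\infty}\|dB(\eta)\|\,e^{\delta|\eta|}<\infty$$ for some $\delta>0$, and let $f:\mathbb R\to\mathbb X$ be bounded and continuous. Consider the equation $$\dot u(t)=Au(t)+\int_{-\infty}^{\infty}dB(\eta)\,u(t+\eta)+f(t),\qquad t\in\mathbb R. \tag{1}$$ A bounded uniformly continuous function $u:\mathbb R\to\mathbb X$ is a mild solution of (1) if for all $t\in\mathbb R$ one has $\int_0^t u(\xi)\,d\xi\in D(A)$ and $$u(t)-u(0)=A\int_0^t u(\xi)\,d\xi+\int_0^t\Big[\int_{-\infty}^{\infty}dB(\eta)\,u(\xi+\eta)+f(\xi)\Big]d\xi .$$ For a bounded continuous $g:\mathbb R\to\mathbb X$ let $\hat g(\lambda)=\int_0^\infty e^{-\lambda\eta}g(\eta)\,d\eta$ if $\operatorname{Re}\lambda>0$ and $\hat g(\lambda)=-\int_{-\infty}^0 e^{-\lambda\eta}g(\eta)\,d\eta$ if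 $\operatorname{Re}\lambda<0$; the (Carleman) spectrum $sp(g)$ is the set of all $\xi\in\mathbb R$ such that $\hat g$ has no analytic extension to any neighbourhood of $i\xi$. Let $$\Sigma:=\Big\{z\in\mathbb C:\ |\operatorname{Re}z|<\delta,\ z-A-\int_{-\infty}^{\infty}dB(\eta)\,e^{z\eta}\ \text{ has no inverse in } L(\mathbb X)\Big\},\qquad \Sigma_i:=\{\xi\in\mathbb R:\ i\xi\in\Sigma\}.$$ Then every bounded uniformly continuous mild solution $u$ of (1) satisfies $$sp(u)\subset\Sigma_i\cup sp(f).$$ -/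

import Mathlib

open Set MeasureTheory
open scoped ENNReal

noncomputable section

namespace FunctionalDE

variable {X : Type*} [NormedAddCommGroup X] [NormedSpace ℂ X]

/-- `g ∈ BC(ℝ, X)`: bounded and continuous. -/
def IsBC (g : ℝ → X) : Prop :=
  Continuous g ∧ ∃ C : ℝ, ∀ t, ‖g t‖ ≤ C

/-- `g ∈ BUC(ℝ, X)`: bounded and uniformly continuous. -/
def IsBUC (g : ℝ → X) : Prop :=
  UniformContinuous g ∧ ∃ C : ℝ, ∀ t, ‖g t‖ ≤ C

/-- The Carleman-Laplace transform of `g`: `∫₀^∞ e^{-zη} g(η) dη` for `Re z > 0` and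
`-∫_{-∞}^0 e^{-zη} g(η) dη` for `Re z < 0`. The value for `Re z = 0` is never used. -/
def carlemanTransform (g : ℝ → X) (z : ℂ) : X :=
  if 0 < z.re then ∫ η in Ioi (0 : ℝ), Complex.exp (-z * η) • g η
  else -∫ η in Iio (0 : ℝ), Complex.exp (-z * η) • g η

/-- The (Carleman) spectrum `sp(g)`: the reals `ξ` such that the Carleman-Laplace transform of `g`,
a function on `ℂ \ iℝ`, has no analytic extension to any neighbourhood of `iξ`. -/
def sp (g : ℝ → X) : Set ℝ :=
  {ξ | ¬ ∃ V : Set ℂ, IsOpen V ∧ Complex.I * (ξ : ℂ) ∈ V ∧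
    ∃ h : ℂ → X, AnalyticOnNhd ℂ h V ∧ ∀ z ∈ V, z.re ≠ 0 → h z = carlemanTransform g z}

/-- The evaluation pairing `(x, T) ↦ T x` of `X` with `L(X)`. -/
def applyPairing (X : Type*) [NormedAddCommGroup X] [NormedSpace ℂ X] :
    X →L[ℝ] (X →L[ℂ] X) →L[ℝ] X :=
  (ContinuousLinearMap.apply ℂ X).bilinearRestrictScalars ℝ

/-- The pairing `(c, T) ↦ c T` of `ℂ` with `L(X)`. -/
def smulPairing (X : Type*) [NormedAddCommGroup X] [NormedSpace ℂ X] :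
    ℂ →L[ℝ] (X →L[ℂ] X) →L[ℝ] (X →L[ℂ] X) :=
  (ContinuousLinearMap.lsmul ℂ ℂ).bilinearRestrictScalars ℝ

theorem applyPairing_apply (x : X) (T : X →L[ℂ] X) : applyPairing X x T = T x := rfl

theorem smulPairing_apply (c : ℂ) (T : X →L[ℂ] X) : smulPairing X c T = c • T := rfl

section Stieltjes

variable [CompleteSpace X] {B : ℝ → X →L[ℂ] X}

/-- `∫ ‖dB(η)‖ e^{δ|η|} < ∞`, where `‖dB‖` is the total variation of the `L(X)`-valued Stieltjes
measure `dB` of the function `B` of bounded variation. -/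
def HasExpMoment (hB : BoundedVariationOn B univ) (δ : ℝ) : Prop :=
  ∫⁻ η : ℝ, ENNReal.ofReal (Real.exp (δ * |η|)) ∂hB.vectorMeasure.variation < ∞

/-- `[𝓑u](t) = ∫ dB(η) u(t + η)`. -/
def functionalTerm (hB : BoundedVariationOn B univ) (u : ℝ → X) (t : ℝ) : X :=
  hB.vectorMeasure.integral (fun η : ℝ => u (t + η)) (applyPairing X)

/-- The bounded operator `∫ dB(η) e^{zη}`. -/
def charIntegral (hB : BoundedVariationOn B univ) (z : ℂ) : X →L[ℂ] X :=
  hB.vectorMeasure.integral (fun η : ℝ => Complex.exp (z * η)) (smulPairing X)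

/-- `u` is a mild solution on `ℝ` of `u' = A u + ∫ dB(η) u(t + η) + f`: it lies in `BUC(ℝ, X)`, and
for every real `t` the vector `∫₀ᵗ u` lies in `D(A)` and
`u(t) - u(0) = A ∫₀ᵗ u + ∫₀ᵗ ([𝓑u](ξ) + f(ξ)) dξ`. -/
def IsMildSolution (A : X →ₗ.[ℂ] X) (hB : BoundedVariationOn B univ) (f u : ℝ → X) : Prop :=
  IsBUC u ∧ ∀ t : ℝ, ∃ h : (∫ ξ in (0 : ℝ)..t, u ξ) ∈ A.domain,
    u t - u 0 = A ⟨∫ ξ in (0 : ℝ)..t, u ξ, h⟩ +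
      ∫ ξ in (0 : ℝ)..t, (functionalTerm hB u ξ + f ξ)

/-- The characteristic operator `z - A - ∫ dB(η) e^{zη}`, with domain `D(A)`. -/
def charOperator (A : X →ₗ.[ℂ] X) (hB : BoundedVariationOn B univ) (z : ℂ) : X →ₗ.[ℂ] X where
  domain := A.domain
  toFun := (z • LinearMap.id - (charIntegral hB z : X →ₗ[ℂ] X)) ∘ₗ A.domain.subtype - A.toFun

/-- The operator `T` (with its domain) has an inverse in `L(X)`. -/
def HasBoundedInverse (T : X →ₗ.[ℂ] X) : Prop :=
  ∃ R : X →L[ℂ] X, (∀ x : X, ∃ h : R x ∈ T.domain, T ⟨R x, h⟩ = x) ∧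
    ∀ x : T.domain, R (T x) = x

/-- The characteristic set `Σ`: the `z` with `|Re z| < δ` such that
`z - A - ∫ dB(η) e^{zη}` has no inverse in `L(X)`. -/
def charSet (A : X →ₗ.[ℂ] X) (hB : BoundedVariationOn B univ) (δ : ℝ) : Set ℂ :=
  {z | |z.re| < δ ∧ ¬ HasBoundedInverse (charOperator A hB z)}

/-- `Σ_i = {ξ ∈ ℝ : iξ ∈ Σ}`. -/
def imagCharSet (A : X →ₗ.[ℂ] X) (hB : BoundedVariationOn B univ) (δ : ℝ) : Set ℝ :=
  {ξ | Complex.I * (ξ : ℂ) ∈ charSet A hB δ}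

end Stieltjes

end FunctionalDE

end

open Set MeasureTheory Filter Topology
open scoped ENNReal BoundedContinuousFunction

noncomputable section

/-! Write û for the Carleman transform of u and β(z) = ∫ dB(η) e^{zη}. For 0 < |Re z| < δ the
equation transforms, formally, into (z - A - β(z)) û(z) = u(0) + f̂(z) - b(z). Here b
(`boundaryTerm`) collects the finite integrals by which the transform of u(· + η) differs from
e^{zη} û (`carlemanTransform_functionalTerm_eq_sub`). The exponential moment makes β and b
holomorphic on the whole strip |Re z| < δ, across the imaginary axis. Let z₀ = iξ with ξ outside Σ_i
and sp(f), and let R be the inverse at z₀. Then (1 - M(z)) û(z) = R(u(0) + f̂(z) - b(z)) with M(z) =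
R(z₀ - z + β(z) - β(z₀)), by `carlemanTransform_eq_of_leftInverse`. Since M(z₀) = 0, the operator 1
- M(z) is invertible near z₀, and an extension of f̂ yields one of û. R is applied to the integrated
equation before transforming, so the unbounded A never passes through an integral. -/

namespace FunctionalDE

/-! ### Carleman transform: primitives, constants, translations. -/

section CarlemanTransform

variable {X : Type*} [NormedAddCommGroup X] [NormedSpace ℂ X]

/-- The integral kernel of the Carleman transform. -/
def carlemanKernel (z : ℂ) (t : ℝ) : ℂ :=
  if 0 < z.re then (Ioi (0 : ℝ)).indicator (fun s : ℝ => Complex.exp (-z * s)) t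
  else -(Iio (0 : ℝ)).indicator (fun s : ℝ => Complex.exp (-z * s)) t

/-- A single integral over ℝ lets bounded operators be moved through the transform in both
half-planes at once. -/
theorem carlemanTransform_eq_integral (g : ℝ → X) (z : ℂ) :
    carlemanTransform g z = ∫ t, carlemanKernel z t • g t := by
  unfold carlemanTransform carlemanKernel
  split_ifs
  · rw [← integral_indicator measurableSet_Ioi]
    simp only [indicator_smul_apply_left]
  · rw [← integral_indicator measurableSet_Iio, ← integral_neg]
    simp only [indicator_smul_apply_left, neg_smul]

theorem measurable_carlemanKernel (z : ℂ) : Measurable (carlemanKernel z) := by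
  have h : Measurable fun s : ℝ => Complex.exp (-z * s) := by fun_prop
  unfold carlemanKernel
  split_ifs
  · exact h.indicator measurableSet_Ioi
  · exact (h.indicator measurableSet_Iio).neg

theorem norm_carlemanKernel_le (z : ℂ) (t : ℝ) :
    ‖carlemanKernel z t‖ ≤ Real.exp (-|z.re| * |t|) := by
  unfold carlemanKernel
  split_ifs with hz
  · rw [norm_indicator_eq_indicator_norm]
    refine indicator_le' (f := fun s : ℝ => ‖Complex.exp (-z * s)‖)
      (g := fun s : ℝ => Real.exp (-|z.re| * |s|)) ?_ ?_ t
    · intro s hs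
      simp [Complex.norm_exp, abs_of_pos hz, abs_of_pos (mem_Ioi.1 hs)]
    · intro s _
      positivity
  · rw [norm_neg]
    rw [norm_indicator_eq_indicator_norm]
    refine indicator_le' (f := fun s : ℝ => ‖Complex.exp (-z * s)‖)
      (g := fun s : ℝ => Real.exp (-|z.re| * |s|)) ?_ ?_ t
    · intro s hs
      simp [Complex.norm_exp, abs_of_nonpos (not_lt.1 hz), abs_of_neg (mem_Iio.1 hs)]
    · intro s _
      positivity

theorem integrable_exp_neg_mul_abs {r : ℝ} (hr : 0 < r) :
    Integrable fun t : ℝ => Real.exp (-r * |t|) := by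
  rw [← integrableOn_univ, ← Iic_union_Ioi (a := (0 : ℝ))]
  refine IntegrableOn.union ?_ ?_
  · refine (integrableOn_exp_mul_Iic hr 0).congr_fun (fun t ht => ?_) measurableSet_Iic
    simp [abs_of_nonpos (mem_Iic.1 ht)]
  · refine (integrableOn_exp_mul_Ioi (neg_lt_zero.2 hr) 0).congr_fun (fun t ht => ?_)
      measurableSet_Ioi
    simp [abs_of_pos (mem_Ioi.1 ht)]

theorem one_add_le_mul_exp {r s : ℝ} (hr : 0 < r) (hs : 0 ≤ s) :
    1 + s ≤ (1 + r⁻¹) * Real.exp (r * s) := by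
  have h1 : r * s + 1 ≤ Real.exp (r * s) := Real.add_one_le_exp _
  have h2 : 0 ≤ r * s := by positivity
  have h3 : s ≤ r⁻¹ * Real.exp (r * s) := by
    rw [inv_mul_eq_div, le_div_iff₀ hr]; linarith
  linarith

/-- Half of the decay rate |Re z| absorbs the linear growth, which must be allowed because
primitives of bounded functions have it. -/
theorem integrable_carlemanKernel_smul {z : ℂ} (hz : z.re ≠ 0) {g : ℝ → X} (hg : Continuous g)
    {C : ℝ} (hC : ∀ t, ‖g t‖ ≤ C * (1 + |t|)) :
    Integrable fun t => carlemanKernel z t • g t := by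
  have hr : 0 < |z.re| / 2 := by positivity
  have hC0 : 0 ≤ C := by simpa using (norm_nonneg _).trans (hC 0)
  refine ((integrable_exp_neg_mul_abs hr).const_mul (C * (1 + (|z.re| / 2)⁻¹))).mono'
    ((measurable_carlemanKernel z).aestronglyMeasurable.smul hg.aestronglyMeasurable)
    (ae_of_all _ fun t => ?_)
  rw [norm_smul]
  calc ‖carlemanKernel z t‖ * ‖g t‖
      ≤ Real.exp (-|z.re| * |t|) * (C * ((1 + (|z.re| / 2)⁻¹) * Real.exp (|z.re| / 2 * |t|))) := by
        gcongr
        · exact norm_carlemanKernel_le z t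
        · exact (hC t).trans (by gcongr; exact one_add_le_mul_exp hr (abs_nonneg t))
    _ = C * (1 + (|z.re| / 2)⁻¹) * (Real.exp (-|z.re| * |t|) * Real.exp (|z.re| / 2 * |t|)) := by
        ring
    _ = _ := by rw [← Real.exp_add]; ring_nf

theorem integrable_carlemanKernel_smul_of_bounded {z : ℂ} (hz : z.re ≠ 0) {g : ℝ → X}
    (hg : IsBC g) : Integrable fun t => carlemanKernel z t • g t := by
  obtain ⟨hg, C, hC⟩ := hg
  refine integrable_carlemanKernel_smul hz hg (C := C) fun t => (hC t).trans ?_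
  have := (norm_nonneg _).trans (hC t)
  nlinarith [abs_nonneg t]

omit [NormedSpace ℂ X] in
theorem IsBC.comp_neg {g : ℝ → X} (hg : IsBC g) : IsBC fun t => g (-t) :=
  ⟨hg.1.comp continuous_neg, hg.2.imp fun _ h t => h (-t)⟩

omit [NormedSpace ℂ X] in
theorem IsBC.add {f g : ℝ → X} (hf : IsBC f) (hg : IsBC g) : IsBC fun t => f t + g t := by
  obtain ⟨hf, C, hC⟩ := hf
  obtain ⟨hg, D, hD⟩ := hg
  exact ⟨hf.add hg, C + D, fun t => (norm_add_le _ _).trans (add_le_add (hC t) (hD t))⟩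

omit [NormedSpace ℂ X] in
theorem isBC_const (x : X) : IsBC fun _ : ℝ => x := ⟨continuous_const, ‖x‖, fun _ => le_rfl⟩

theorem norm_primitive_le {g : ℝ → X} {C : ℝ} (hC : ∀ t, ‖g t‖ ≤ C) (t : ℝ) :
    ‖∫ s in (0 : ℝ)..t, g s‖ ≤ C * (1 + |t|) := by
  have h := intervalIntegral.norm_integral_le_of_norm_le_const (a := (0 : ℝ)) (b := t)
    fun s _ => hC s
  have := (norm_nonneg _).trans (hC t)
  rw [sub_zero] at h
  linarith

theorem continuous_primitive_zero [CompleteSpace X] {g : ℝ → X} (hg : Continuous g) :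
    Continuous fun t : ℝ => ∫ s in (0 : ℝ)..t, g s :=
  intervalIntegral.continuous_primitive (fun _ _ => hg.intervalIntegrable _ _) 0

theorem integrable_carlemanKernel_smul_primitive [CompleteSpace X] {z : ℂ} (hz : z.re ≠ 0)
    {g : ℝ → X} (hg : IsBC g) :
    Integrable fun t => carlemanKernel z t • ∫ s in (0 : ℝ)..t, g s := by
  obtain ⟨hg, C, hC⟩ := hg
  exact integrable_carlemanKernel_smul hz (continuous_primitive_zero hg) (norm_primitive_le hC)

theorem carlemanKernel_neg_neg {z : ℂ} (hz : z.re ≠ 0) (t : ℝ) :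
    carlemanKernel (-z) (-t) = -carlemanKernel z t := by
  unfold carlemanKernel
  rcases hz.lt_or_gt with h | h <;>
  simp [h, h.not_gt, indicator_apply]

theorem carlemanTransform_comp_neg {z : ℂ} (hz : z.re ≠ 0) (g : ℝ → X) :
    carlemanTransform (fun t => g (-t)) (-z) = -carlemanTransform g z := by
  rw [carlemanTransform_eq_integral, carlemanTransform_eq_integral, ← integral_neg,
    ← integral_neg_eq_self]
  simp [carlemanKernel_neg_neg hz]

/-- Reflection reduces identities for the Carleman transform to the right half-plane. -/
theorem carlemanTransform_eq_neg {z : ℂ} (hz : z.re ≠ 0) (g : ℝ → X) :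
    carlemanTransform g z = -carlemanTransform (fun t => g (-t)) (-z) := by
  rw [carlemanTransform_comp_neg hz, neg_neg]

theorem integrableOn_exp_smul {z : ℂ} (hz : 0 < z.re) {g : ℝ → X} (hg : Continuous g)
    {C : ℝ} (hC : ∀ t, ‖g t‖ ≤ C * (1 + |t|)) :
    IntegrableOn (fun t : ℝ => Complex.exp (-z * t) • g t) (Ioi 0) := by
  rw [← integrable_indicator_iff measurableSet_Ioi]
  refine (integrable_carlemanKernel_smul hz.ne' hg hC).congr (ae_of_all _ fun t => ?_)
  simp [carlemanKernel, hz, indicator_smul_apply_left]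

theorem hasDerivAt_exp_neg_mul (z : ℂ) (t : ℝ) :
    HasDerivAt (fun s : ℝ => Complex.exp (-z * s)) (-z * Complex.exp (-z * t)) t := by
  have h := (((hasDerivAt_id (t : ℂ)).const_mul (-z)).cexp).comp_ofReal
  simpa [mul_comm] using h

theorem carlemanTransform_primitive_of_pos [CompleteSpace X] {z : ℂ} (hz : 0 < z.re) {g : ℝ → X}
    (hg : IsBC g) :
    z • carlemanTransform (fun t => ∫ s in (0 : ℝ)..t, g s) z = carlemanTransform g z := by
  obtain ⟨hg, C, hC⟩ := hg
  have hC0 := (norm_nonneg _).trans (hC 0)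
  set G : ℝ → X := fun t => ∫ s in (0 : ℝ)..t, g s with hG
  have hderiv (t : ℝ) : HasDerivAt (fun s : ℝ => Complex.exp (-z * s) • G s)
      (Complex.exp (-z * t) • g t - z • Complex.exp (-z * t) • G t) t := by
    have h := (hasDerivAt_exp_neg_mul z t).smul (hg.integral_hasStrictDerivAt 0 t).hasDerivAt
    refine h.congr_deriv ?_
    rw [mul_smul (-z), neg_smul z, ← sub_eq_add_neg]
  have hintG := integrableOn_exp_smul hz (continuous_primitive_zero hg) (norm_primitive_le hC)
  have hintg : IntegrableOn (fun t : ℝ => Complex.exp (-z * t) • g t) (Ioi 0) :=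
    integrableOn_exp_smul hz hg (C := C) fun t => (hC t).trans
      (le_mul_of_one_le_right hC0 (by linarith [abs_nonneg t]))
  have hint' : IntegrableOn (fun t : ℝ =>
      Complex.exp (-z * t) • g t - z • Complex.exp (-z * t) • G t) (Ioi 0) :=
    hintg.sub (hintG.smul z)
  -- Integration by parts: the boundary term at infinity vanishes because the function and its
  -- derivative are both integrable.
  have h := integral_Ioi_of_hasDerivAt_of_tendsto' (fun t _ => hderiv t) hint'
    (tendsto_zero_of_hasDerivAt_of_integrableOn_Ioi (fun t _ => hderiv t) hint' hintG)
  rw [integral_sub hintg (g := fun t : ℝ => z • Complex.exp (-z * t) • G t) (hintG.smul z),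
    integral_smul] at h
  simp only [hG, intervalIntegral.integral_same, smul_zero, sub_zero, sub_eq_zero] at h
  simp only [carlemanTransform, hz, if_true]
  exact h.symm

theorem carlemanTransform_neg (g : ℝ → X) (z : ℂ) :
    carlemanTransform (fun t => -g t) z = -carlemanTransform g z := by
  simp [carlemanTransform_eq_integral, integral_neg]

theorem carlemanTransform_primitive [CompleteSpace X] {z : ℂ} (hz : z.re ≠ 0) {g : ℝ → X}
    (hg : IsBC g) :
    z • carlemanTransform (fun t => ∫ s in (0 : ℝ)..t, g s) z = carlemanTransform g z := by
  rcases hz.lt_or_gt with h | h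
  · have key := carlemanTransform_primitive_of_pos (z := -z) (by simpa using h) hg.comp_neg
    rw [carlemanTransform_eq_neg hz g, ← key, carlemanTransform_eq_neg hz]
    have (t : ℝ) : ∫ s in (0 : ℝ)..-t, g s = -∫ s in (0 : ℝ)..t, g (-s) := by
      rw [intervalIntegral.integral_comp_neg, neg_zero, intervalIntegral.integral_symm]
    simp only [this, carlemanTransform_neg, neg_smul, neg_neg]
  · exact carlemanTransform_primitive_of_pos h hg

theorem carlemanTransform_const [CompleteSpace X] {z : ℂ} (hz : z.re ≠ 0) (x : X) :
    z • carlemanTransform (fun _ => x) z = x := by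
  have hpos {w : ℂ} (hw : 0 < w.re) : w • carlemanTransform (fun _ => x) w = x := by
    have hw0 : w ≠ 0 := by rintro rfl; simp at hw
    simp only [carlemanTransform, hw, if_true]
    rw [integral_smul_const, integral_exp_mul_complex_Ioi (by simpa using hw), smul_smul]
    simp [hw0]
  rcases hz.lt_or_gt with h | h
  · have key := hpos (w := -z) (by simpa using h)
    rw [carlemanTransform_eq_neg hz, smul_neg, ← neg_smul, key]
  · exact hpos h

/-- Substituting s = t + a moves the half-line to (a, ∞); the correction is the integral over the
interval between 0 and a. -/
theorem carlemanTransform_comp_add_right_of_pos {z : ℂ} (hz : 0 < z.re) {g : ℝ → X}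
    (hg : IsBC g) (a : ℝ) :
    carlemanTransform (fun t => g (t + a)) z = Complex.exp (z * a) •
      (carlemanTransform g z - ∫ s in (0 : ℝ)..a, Complex.exp (-z * s) • g s) := by
  have hint (b : ℝ) : IntegrableOn (fun t : ℝ => Complex.exp (-z * t) • g t) (Ioi b) := by
    have h0 : IntegrableOn (fun t : ℝ => Complex.exp (-z * t) • g t) (Ioi 0) := by
      rw [← integrable_indicator_iff measurableSet_Ioi]
      refine (integrable_carlemanKernel_smul_of_bounded hz.ne' hg).congr (ae_of_all _ fun t => ?_)
      simp [carlemanKernel, hz, indicator_smul_apply_left]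
    have hc : Continuous fun t : ℝ => Complex.exp (-z * t) • g t := by
      have := hg.1; fun_prop
    refine ((hc.integrableOn_Icc (a := b) (b := 0)).union h0).mono_set fun t ht => ?_
    rcases le_or_gt t 0 with h | h
    · exact Or.inl ⟨(mem_Ioi.1 ht).le, h⟩
    · exact Or.inr h
  rw [← intervalIntegral.integral_Ioi_sub_Ioi' (hint 0) (hint a)]
  simp only [carlemanTransform, hz, if_true, sub_sub_cancel]
  rw [← integral_smul]
  have h := (measurePreserving_add_right (volume : Measure ℝ) a).setIntegral_preimage_emb
    (measurableEmbedding_addRight a)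
    (fun s : ℝ => Complex.exp (z * a) • Complex.exp (-z * s) • g s) (Ioi a)
  rw [← h]
  have : (fun x : ℝ => x + a) ⁻¹' Ioi a = Ioi 0 := by ext; simp
  rw [this]
  congr 1 with t
  rw [smul_smul, ← Complex.exp_add]
  congr 2
  push_cast
  ring

theorem carlemanTransform_comp_add_right {z : ℂ} (hz : z.re ≠ 0) {g : ℝ → X}
    (hg : IsBC g) (a : ℝ) :
    carlemanTransform (fun t => g (t + a)) z = Complex.exp (z * a) •
      (carlemanTransform g z - ∫ s in (0 : ℝ)..a, Complex.exp (-z * s) • g s) := by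
  rcases hz.lt_or_gt with h | h
  · have key := carlemanTransform_comp_add_right_of_pos (z := -z) (by simpa using h)
      hg.comp_neg (-a)
    rw [carlemanTransform_eq_neg hz, carlemanTransform_eq_neg hz g]
    have h1 : (fun t => g (-t + a)) = fun t => g (-(t + -a)) := by
      ext t; congr 1; ring
    have h2 : ∫ s in (0 : ℝ)..a, Complex.exp (-z * s) • g s =
        -∫ s in (0 : ℝ)..-a, Complex.exp (- -z * s) • g (-s) := by
      have h3 := intervalIntegral.integral_comp_neg (a := 0) (b := -a)
        fun s : ℝ => Complex.exp (-z * s) • g s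
      rw [neg_neg, neg_zero] at h3
      rw [intervalIntegral.integral_symm, ← h3]
      simp only [Complex.ofReal_neg, neg_mul, mul_neg, neg_neg]
    rw [h1, key, h2]
    simp only [Complex.ofReal_neg, neg_mul_neg, ← smul_neg]
    congr 1
    abel
  · exact carlemanTransform_comp_add_right_of_pos h hg a

end CarlemanTransform

/-! ### Holomorphic dependence of integrals on z. -/

section HolomorphicIntegrals

section Holomorphic

variable {α E F : Type*} [MeasurableSpace α] [NormedAddCommGroup E] [NormedSpace ℂ E]
  [NormedAddCommGroup F] [NormedSpace ℂ F]

/-- Holomorphic dependence of an integral on a parameter; the derivative of the integrand is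
controlled by Cauchy's estimate. -/
theorem differentiableOn_setToFun_of_dominated {μ : Measure α} {T : Set α → E →L[ℝ] F} {C : ℝ}
    (hT : DominatedFinMeasAdditive μ T C) (hsmul : ∀ (c : ℂ) (s : Set α) (x : E),
      T s (c • x) = c • T s x) {Φ : ℂ → α → E} {U : Set ℂ} (hU : IsOpen U) {b : α → ℝ}
    (hb : Integrable b μ) (hmeas : ∀ z ∈ U, AEStronglyMeasurable (Φ z) μ)
    (hdiff : ∀ a, DifferentiableOn ℂ (fun z => Φ z a) U) (hbound : ∀ z ∈ U, ∀ a, ‖Φ z a‖ ≤ b a) :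
    DifferentiableOn ℂ (fun z => setToFun μ T hT (Φ z)) U := by
  intro z₀ hz₀
  obtain ⟨ε, hε, hεU⟩ := Metric.isOpen_iff.1 hU z₀ hz₀
  -- Closed discs of radius r centred in the ball of radius r stay in U, so Cauchy's estimate bounds
  -- the derivative by b a / r there.
  set r := ε / 3 with hr_def
  have hr : 0 < r := by positivity
  have hlip (a : α) {z : ℂ} (hz : z ∈ Metric.ball z₀ r) :
      ‖Φ z a - Φ z₀ a‖ ≤ b a / r * ‖z - z₀‖ := by
    refine (convex_ball z₀ r).norm_image_sub_le_of_norm_deriv_le (𝕜 := ℂ)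
      (f := fun z => Φ z a) (fun w hw => ?_) (fun w hw => ?_) (Metric.mem_ball_self hr) hz
    · refine (hdiff a).differentiableAt (hU.mem_nhds (hεU ?_))
      exact Metric.ball_subset_ball (by linarith) hw
    · have hsub : Metric.closedBall w r ⊆ U := by
        intro v hv
        apply hεU
        rw [Metric.mem_ball] at hw ⊢
        rw [Metric.mem_closedBall] at hv
        linarith [dist_triangle v w z₀]
      refine Complex.norm_deriv_le_of_forall_mem_sphere_norm_le hr ?_ fun v hv =>
        hbound v (hsub (Metric.sphere_subset_closedBall hv)) a
      exact ((hdiff a).mono (closure_ball w hr.ne' ▸ hsub)).diffContOnCl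
  have hball : Metric.ball z₀ r ∈ 𝓝 z₀ := Metric.ball_mem_nhds z₀ hr
  have hint {z : ℂ} (hz : z ∈ U) : Integrable (Φ z) μ :=
    hb.mono' (hmeas z hz) (ae_of_all _ (hbound z hz))
  have hmem {z : ℂ} (hz : z ∈ Metric.ball z₀ r) : z ∈ U :=
    hεU (Metric.ball_subset_ball (by linarith) hz)
  refine (HasDerivAt.differentiableAt (f' := setToFun μ T hT fun a => deriv (fun z => Φ z a) z₀)
    ?_).differentiableWithinAt
  rw [hasDerivAt_iff_tendsto_slope]
  have hlim : Tendsto (fun z => setToFun μ T hT fun a => slope (fun z => Φ z a) z₀ z) (𝓝[≠] z₀)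
      (𝓝 (setToFun μ T hT fun a => deriv (fun z => Φ z a) z₀)) := by
    refine tendsto_setToFun_filter_of_dominated_convergence hT (fun a => b a / r) ?_ ?_
      (hb.div_const r) (ae_of_all _ fun a => ?_)
    · filter_upwards [nhdsWithin_le_nhds hball] with z hz
      simp only [slope_def_module]
      exact ((hmeas z (hmem hz)).sub (hmeas z₀ hz₀)).const_smul _
    · filter_upwards [nhdsWithin_le_nhds hball, self_mem_nhdsWithin] with z hz hne
      refine ae_of_all _ fun a => ?_
      have : 0 < ‖z - z₀‖ := norm_pos_iff.2 (sub_ne_zero.2 hne)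
      rw [slope_def_module, norm_smul, norm_inv, inv_mul_le_iff₀ this, mul_comm]
      exact hlip a hz
    · exact hasDerivAt_iff_tendsto_slope.1
        ((hdiff a).differentiableAt (hU.mem_nhds hz₀)).hasDerivAt
  refine hlim.congr' ?_
  filter_upwards [nhdsWithin_le_nhds hball] with z hz
  rw [slope_def_module, ← setToFun_sub hT (hint (hmem hz)) (hint hz₀),
    ← setToFun_smul hT hsmul]
  congr 1

end Holomorphic

variable {X : Type*} [NormedAddCommGroup X] [NormedSpace ℂ X]

theorem norm_exp_mul_le {z : ℂ} {δ : ℝ} (hz : |z.re| ≤ δ) {s a : ℝ} (hs : |s| ≤ a) :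
    ‖Complex.exp (z * s)‖ ≤ Real.exp (δ * a) := by
  rw [Complex.norm_exp, Real.exp_le_exp, Complex.re_mul_ofReal]
  calc z.re * s ≤ |z.re| * |s| := by rw [← abs_mul]; exact le_abs_self _
    _ ≤ δ * a := mul_le_mul hz hs (abs_nonneg _) ((abs_nonneg _).trans hz)

theorem isOpen_strip (δ : ℝ) : IsOpen {z : ℂ | |z.re| < δ} :=
  isOpen_lt (continuous_abs.comp Complex.continuous_re) continuous_const

/-- `∫₀ᵃ e^{z(a - s)} u(s) ds`, the part of the shifted transform that stays regular across the
imaginary axis. -/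
def expConvolution (u : ℝ → X) (z : ℂ) (a : ℝ) : X :=
  ∫ s in (0 : ℝ)..a, Complex.exp (z * ((a - s : ℝ) : ℂ)) • u s

theorem expConvolution_eq (u : ℝ → X) (z : ℂ) (a : ℝ) :
    expConvolution u z a =
      Complex.exp (z * a) • ∫ s in (0 : ℝ)..a, Complex.exp (-z * s) • u s := by
  rw [expConvolution, ← intervalIntegral.integral_smul]
  congr 1 with s
  rw [smul_smul, ← Complex.exp_add]
  congr 2
  push_cast
  ring

/-- Here a - s lies between 0 and a. Bounding the factors e^{za} and e^{-zs} separately could cost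
e^{2δ|a|}, more than the moment condition provides. -/
theorem norm_exp_sub_smul_le {u : ℝ → X} {C : ℝ} (hC : ∀ t, ‖u t‖ ≤ C) {z : ℂ} {δ : ℝ}
    (hz : |z.re| ≤ δ) {a s : ℝ} (hs : s ∈ uIoc 0 a) :
    ‖Complex.exp (z * ((a - s : ℝ) : ℂ)) • u s‖ ≤ Real.exp (δ * |a|) * C := by
  rw [norm_smul]
  gcongr
  · refine norm_exp_mul_le hz ?_
    rcases le_total 0 a with h | h
    · rw [uIoc_of_le h] at hs
      rw [abs_of_nonneg h, abs_of_nonneg] <;> linarith [hs.1, hs.2]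
    · rw [uIoc_of_ge h] at hs
      rw [abs_of_nonpos h, abs_of_nonpos] <;> linarith [hs.1, hs.2]
  · exact hC s

theorem norm_expConvolution_le {u : ℝ → X} {C : ℝ} (hC : ∀ t, ‖u t‖ ≤ C) {z : ℂ} {δ : ℝ}
    (hz : |z.re| ≤ δ) (a : ℝ) : ‖expConvolution u z a‖ ≤ C * (Real.exp (δ * |a|) * |a|) := by
  refine (intervalIntegral.norm_integral_le_of_norm_le_const fun s hs =>
    norm_exp_sub_smul_le hC hz hs).trans_eq ?_
  rw [sub_zero]
  ring

theorem continuous_expConvolution [CompleteSpace X] {u : ℝ → X} (hu : Continuous u) (z : ℂ) :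
    Continuous (expConvolution u z) := by
  have h : Continuous fun s : ℝ => Complex.exp (-z * s) • u s := by fun_prop
  have h2 := continuous_primitive_zero h
  have : expConvolution u z = fun a : ℝ =>
      Complex.exp (z * a) • ∫ s in (0 : ℝ)..a, Complex.exp (-z * s) • u s :=
    funext (expConvolution_eq u z)
  rw [this]
  fun_prop

theorem differentiableOn_expConvolution {u : ℝ → X} (hu : IsBC u) (δ a : ℝ) :
    DifferentiableOn ℂ (fun z => expConvolution u z a) {z : ℂ | |z.re| < δ} := by
  obtain ⟨hu, C, hC⟩ := hu
  simp only [expConvolution, intervalIntegral.intervalIntegral_eq_integral_uIoc]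
  refine DifferentiableOn.const_smul ?_ _
  simp only [integral_eq_setToFun]
  have : IsFiniteMeasure (volume.restrict (uIoc 0 a)) := by unfold uIoc; infer_instance
  have key := differentiableOn_setToFun_of_dominated (μ := volume.restrict (uIoc 0 a))
    (dominatedFinMeasAdditive_weightedSMul (F := X) (volume.restrict (uIoc 0 a)))
    (fun c s x => by simpa only [weightedSMul_apply] using smul_comm _ _ _)
    -- The general lemma asks for its bound at every s, hence the cut-off outside the interval.
    (Φ := fun z s => (uIoc 0 a).indicator
      (fun s : ℝ => Complex.exp (z * ((a - s : ℝ) : ℂ)) • u s) s)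
    (isOpen_strip δ) (b := fun _ => Real.exp (δ * |a|) * C) (integrable_const _) ?_ ?_ ?_
  · refine key.congr fun z _ => setToFun_congr_ae _ ?_
    filter_upwards [ae_restrict_mem measurableSet_uIoc] with s hs
    rw [indicator_of_mem hs]
  · intro z _
    refine AEStronglyMeasurable.indicator ?_ measurableSet_uIoc
    exact Continuous.aestronglyMeasurable (by fun_prop)
  · intro s
    by_cases hs : s ∈ uIoc 0 a
    · simp only [indicator_of_mem hs]
      exact Differentiable.differentiableOn (by fun_prop)
    · simp only [indicator_of_notMem hs]
      exact differentiableOn_const _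
  · intro z hz s
    by_cases hs : s ∈ uIoc 0 a
    · rw [indicator_of_mem hs]
      exact norm_exp_sub_smul_le hC (le_of_lt hz) hs
    · rw [indicator_of_notMem hs, norm_zero]
      have := (norm_nonneg _).trans (hC 0)
      positivity

end HolomorphicIntegrals

/-! ### Stieltjes integrals against dB and the transform of the functional term. -/

section StieltjesFunctional

variable {X : Type*} [NormedAddCommGroup X] [NormedSpace ℂ X] [CompleteSpace X]
  {B : ℝ → X →L[ℂ] X} {hB : BoundedVariationOn B univ} {δ : ℝ}

theorem HasExpMoment.integrable_exp (hδ : HasExpMoment hB δ) :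
    Integrable (fun η : ℝ => Real.exp (δ * |η|)) hB.vectorMeasure.variation := by
  refine ⟨Continuous.aestronglyMeasurable (by fun_prop), ?_⟩
  rw [hasFiniteIntegral_iff_ofReal (ae_of_all _ fun _ => (Real.exp_pos _).le)]
  exact hδ

theorem HasExpMoment.isFiniteMeasure (hδ : HasExpMoment hB δ) (h : 0 < δ) :
    IsFiniteMeasure hB.vectorMeasure.variation := by
  refine ⟨lt_of_le_of_lt ?_ hδ⟩
  rw [← lintegral_one]
  refine lintegral_mono fun η => ?_
  rw [← ENNReal.ofReal_one]
  exact ENNReal.ofReal_le_ofReal (Real.one_le_exp (by positivity))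

theorem transpose_applyPairing_smul (c : ℂ) (s : Set ℝ) (x : X) :
    hB.vectorMeasure.transpose (applyPairing X) s (c • x) =
      c • hB.vectorMeasure.transpose (applyPairing X) s x :=
  (hB.vectorMeasure s).map_smul c x

theorem transpose_smulPairing_smul (c : ℂ) (s : Set ℝ) (x : ℂ) :
    hB.vectorMeasure.transpose (smulPairing X) s (c • x) =
      c • hB.vectorMeasure.transpose (smulPairing X) s x :=
  mul_smul c x (hB.vectorMeasure s)

theorem integral_applyPairing_smul (c : ℂ) (φ : ℝ → X) :
    hB.vectorMeasure.integral (fun η => c • φ η) (applyPairing X) =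
      c • hB.vectorMeasure.integral φ (applyPairing X) :=
  setToFun_smul _ transpose_applyPairing_smul c φ

theorem integrable_boundedContinuousFunction [IsFiniteMeasure hB.vectorMeasure.variation]
    (φ : ℝ →ᵇ X) : hB.vectorMeasure.Integrable φ :=
  Integrable.of_bound φ.continuous.aestronglyMeasurable ‖φ‖ (ae_of_all _ φ.norm_coe_le_norm)

variable (hB) in
/-- The functional `φ ↦ ∫ dB(η) φ(η)` on bounded continuous functions. -/
def stieltjesCLM [IsFiniteMeasure hB.vectorMeasure.variation] : (ℝ →ᵇ X) →L[ℂ] X :=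
  LinearMap.mkContinuousOfExistsBound
    { toFun := fun φ => hB.vectorMeasure.integral φ (applyPairing X)
      map_add' := fun φ ψ => VectorMeasure.integral_fun_add
        (integrable_boundedContinuousFunction φ) (integrable_boundedContinuousFunction ψ)
      map_smul' := fun c φ => integral_applyPairing_smul c φ }
    ⟨_, fun φ => (VectorMeasure.norm_integral_le_of_norm_le_const
      (ae_of_all _ φ.norm_coe_le_norm)).trans_eq ((mul_assoc _ _ _).trans (mul_comm _ _))⟩

theorem stieltjesCLM_apply [IsFiniteMeasure hB.vectorMeasure.variation] (φ : ℝ →ᵇ X) :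
    stieltjesCLM hB φ = hB.vectorMeasure.integral φ (applyPairing X) := rfl

omit [NormedSpace ℂ X] [CompleteSpace X] in
theorem IsBUC.isBC {u : ℝ → X} (hu : IsBUC u) : IsBC u := ⟨hu.1.continuous, hu.2⟩

/-- The translate `η ↦ u(t + η)` as a bounded continuous function. -/
def translate {u : ℝ → X} (hu : IsBUC u) (t : ℝ) : ℝ →ᵇ X :=
  BoundedContinuousFunction.ofNormedAddCommGroup (fun η => u (t + η))
    (hu.1.continuous.comp (continuous_const_add t)) hu.2.choose fun η => hu.2.choose_spec (t + η)

-- Uniform continuity of u gives sup-norm continuity of its translates, so their weighted Bochner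
-- integral can be taken in the space of bounded continuous functions.
omit [NormedSpace ℂ X] [CompleteSpace X] in
theorem isBC_translate {u : ℝ → X} (hu : IsBUC u) : IsBC (translate hu) := by
  have hC := hu.2.choose_spec
  refine ⟨Metric.continuous_iff.2 fun t ε hε => ?_, hu.2.choose, fun t => ?_⟩
  · obtain ⟨ρ, hρ, h⟩ := Metric.uniformContinuous_iff.1 hu.1 (ε / 2) (half_pos hε)
    refine ⟨ρ, hρ, fun s hs => ?_⟩
    refine ((BoundedContinuousFunction.dist_le (half_pos hε).le).2 fun η => ?_).trans_lt
      (half_lt_self hε)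
    exact (h (by simpa using hs)).le
  · exact BoundedContinuousFunction.norm_ofNormedAddCommGroup_le _
      ((norm_nonneg _).trans (hC 0)) _

theorem functionalTerm_eq [IsFiniteMeasure hB.vectorMeasure.variation] {u : ℝ → X}
    (hu : IsBUC u) (t : ℝ) : functionalTerm hB u t = stieltjesCLM hB (translate hu t) := rfl

theorem isBC_functionalTerm [IsFiniteMeasure hB.vectorMeasure.variation] {u : ℝ → X}
    (hu : IsBUC u) : IsBC (functionalTerm hB u) := by
  obtain ⟨hcont, C, hC⟩ := isBC_translate hu
  rw [funext (functionalTerm_eq (hB := hB) hu)]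
  exact ⟨(stieltjesCLM hB).continuous.comp hcont, ‖stieltjesCLM hB‖ * C,
    fun t => (stieltjesCLM hB).le_opNorm_of_le (hC t)⟩

/-- Fubini's theorem for the Carleman transform of the functional term. -/
theorem carlemanTransform_functionalTerm [IsFiniteMeasure hB.vectorMeasure.variation]
    {u : ℝ → X} (hu : IsBUC u) {z : ℂ} (hz : z.re ≠ 0) :
    carlemanTransform (functionalTerm hB u) z =
      hB.vectorMeasure.integral (fun η => carlemanTransform (fun t => u (t + η)) z)
        (applyPairing X) := by
  have hint := integrable_carlemanKernel_smul_of_bounded hz (isBC_translate hu)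
  have h1 : carlemanTransform (functionalTerm hB u) z =
      stieltjesCLM hB (∫ t, carlemanKernel z t • translate hu t) := by
    rw [carlemanTransform_eq_integral, ← ContinuousLinearMap.integral_comp_comm _ hint]
    simp only [functionalTerm_eq hu, map_smul]
  rw [h1, stieltjesCLM_apply]
  congr 1 with η
  -- Evaluation at η is also bounded linear, so the function-valued integral is computed pointwise.
  have h2 := ContinuousLinearMap.integral_comp_comm
    (BoundedContinuousFunction.evalCLM ℂ η : (ℝ →ᵇ X) →L[ℂ] X) hint
  rw [carlemanTransform_eq_integral]
  exact h2.symm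

/-- Both sides are additive and L¹-continuous in c and agree on indicators. This pulls û(z) out of
the Stieltjes integral. -/
theorem integral_smul_const_applyPairing {c : ℝ → ℂ} (hc : hB.vectorMeasure.Integrable c) (x : X) :
    hB.vectorMeasure.integral (fun η => c η • x) (applyPairing X) =
      hB.vectorMeasure.integral c (smulPairing X) x := by
  have hcont : Continuous fun f : ℝ →₁[hB.vectorMeasure.variation] ℂ =>
      hB.vectorMeasure.integral f (smulPairing X) x :=
    (ContinuousLinearMap.apply ℂ X x).continuous.comp VectorMeasure.continuous_integral
  have hcont' : Continuous fun f : ℝ →₁[hB.vectorMeasure.variation] ℂ =>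
      hB.vectorMeasure.integral (fun η => f η • x) (applyPairing X) := by
    have h1 : Continuous fun f : ℝ →₁[hB.vectorMeasure.variation] ℂ =>
        ((ContinuousLinearMap.toSpanSingleton ℂ x).compLp f :
          ℝ →₁[hB.vectorMeasure.variation] X) :=
      ((ContinuousLinearMap.toSpanSingleton ℂ x).compLpL 1 _).continuous
    refine (VectorMeasure.continuous_integral (μ := hB.vectorMeasure)
      (B := applyPairing X)).comp h1 |>.congr fun f => ?_
    refine VectorMeasure.integral_congr_ae ?_
    exact (ContinuousLinearMap.toSpanSingleton ℂ x).coeFn_compLp f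
  refine Integrable.induction (μ := hB.vectorMeasure.variation)
    (fun c : ℝ → ℂ => hB.vectorMeasure.integral (fun η => c η • x) (applyPairing X) =
      hB.vectorMeasure.integral c (smulPairing X) x) ?_ ?_ ?_ ?_ hc
  · intro a s hs hfin
    have h1 : (fun η => s.indicator (fun _ => a) η • x) = s.indicator fun _ => a • x := by
      ext η; simp [indicator_smul_apply_left]
    rw [h1, VectorMeasure.integral_eq_setToFun, VectorMeasure.integral_eq_setToFun,
      setToFun_indicator_const _ hs hfin.ne, setToFun_indicator_const _ hs hfin.ne]
    exact (hB.vectorMeasure s).map_smul a x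
  · intro f g _ hf hg hf' hg'
    rw [VectorMeasure.integral_add hf hg, add_apply, ← hf', ← hg',
      ← VectorMeasure.integral_fun_add (hf.smul_const x) (hg.smul_const x)]
    simp [add_smul]
  · exact isClosed_eq hcont' hcont
  · intro f g hfg _ h
    rw [← VectorMeasure.integral_congr_ae hfg, ← h]
    exact VectorMeasure.integral_congr_ae (hfg.mono fun η hη => by simp [hη])

theorem integrable_exp_mul (hδ : HasExpMoment hB δ) {z : ℂ} (hz : |z.re| ≤ δ) :
    hB.vectorMeasure.Integrable fun η : ℝ => Complex.exp (z * η) :=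
  hδ.integrable_exp.mono' (Continuous.aestronglyMeasurable (by fun_prop))
    (ae_of_all _ fun _ => norm_exp_mul_le hz le_rfl)

theorem differentiableOn_charIntegral (hδ : HasExpMoment hB δ) :
    DifferentiableOn ℂ (charIntegral hB) {z : ℂ | |z.re| < δ} := by
  refine differentiableOn_setToFun_of_dominated _ transpose_smulPairing_smul (isOpen_strip δ)
    hδ.integrable_exp (fun z _ => Continuous.aestronglyMeasurable (by fun_prop))
    (fun η => Differentiable.differentiableOn (by fun_prop))
    (fun z hz η => norm_exp_mul_le (le_of_lt hz) le_rfl)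

variable (hB) in
/-- The difference between `∫ dB(η) e^{zη} û(z)` and the Carleman transform of the functional
term. -/
def boundaryTerm (u : ℝ → X) (z : ℂ) : X :=
  hB.vectorMeasure.integral (expConvolution u z) (applyPairing X)

omit [CompleteSpace X] in
-- The gap δ - r pays for the extra factor |η|. The constant blows up as r → δ, so holomorphy of
-- `boundaryTerm` is proved on smaller strips.
theorem norm_expConvolution_le_exp {u : ℝ → X} {C : ℝ} (hC : ∀ t, ‖u t‖ ≤ C) {z : ℂ} {r : ℝ}
    (hr : r < δ) (hz : |z.re| ≤ r) (η : ℝ) :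
    ‖expConvolution u z η‖ ≤ C * (δ - r)⁻¹ * Real.exp (δ * |η|) := by
  have hC0 := (norm_nonneg _).trans (hC 0)
  have hr' : 0 < δ - r := sub_pos.2 hr
  have h : |η| ≤ (δ - r)⁻¹ * Real.exp ((δ - r) * |η|) := by
    rw [inv_mul_eq_div, le_div_iff₀ hr']
    linarith [Real.add_one_le_exp ((δ - r) * |η|)]
  calc ‖expConvolution u z η‖ ≤ C * (Real.exp (r * |η|) * |η|) := norm_expConvolution_le hC hz η
    _ ≤ C * (Real.exp (r * |η|) * ((δ - r)⁻¹ * Real.exp ((δ - r) * |η|))) := by gcongr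
    _ = C * (δ - r)⁻¹ * (Real.exp (r * |η|) * Real.exp ((δ - r) * |η|)) := by ring
    _ = _ := by rw [← Real.exp_add]; ring_nf

theorem integrable_expConvolution (hδ : HasExpMoment hB δ) {u : ℝ → X} (hu : IsBC u) {z : ℂ}
    (hz : |z.re| < δ) : hB.vectorMeasure.Integrable (expConvolution u z) := by
  obtain ⟨hu, C, hC⟩ := hu
  exact (hδ.integrable_exp.const_mul _).mono' (continuous_expConvolution hu z).aestronglyMeasurable
    (ae_of_all _ (norm_expConvolution_le_exp hC hz le_rfl))

theorem differentiableOn_boundaryTerm (hδ : HasExpMoment hB δ) {u : ℝ → X} (hu : IsBC u) :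
    DifferentiableOn ℂ (boundaryTerm hB u) {z : ℂ | |z.re| < δ} := by
  intro z hz
  obtain ⟨r, hzr, hr⟩ := exists_between (show |z.re| < δ from hz)
  obtain ⟨C, hC⟩ := hu.2
  refine DifferentiableAt.differentiableWithinAt (DifferentiableOn.differentiableAt
    (s := {z : ℂ | |z.re| < r}) ?_ ((isOpen_strip r).mem_nhds hzr))
  exact differentiableOn_setToFun_of_dominated _ transpose_applyPairing_smul (isOpen_strip r)
    (hδ.integrable_exp.const_mul (C * (δ - r)⁻¹))
    (fun z _ => (continuous_expConvolution hu.1 z).aestronglyMeasurable)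
    (fun η => differentiableOn_expConvolution hu r η)
    (fun z hz η => norm_expConvolution_le_exp hC hr (le_of_lt hz) η)

theorem carlemanTransform_functionalTerm_eq_sub [IsFiniteMeasure hB.vectorMeasure.variation]
    (hδ : HasExpMoment hB δ) {u : ℝ → X} (hu : IsBUC u) {z : ℂ} (hz : z.re ≠ 0)
    (hzδ : |z.re| < δ) :
    carlemanTransform (functionalTerm hB u) z =
      charIntegral hB z (carlemanTransform u z) - boundaryTerm hB u z := by
  rw [carlemanTransform_functionalTerm hu hz, charIntegral,
    ← integral_smul_const_applyPairing (integrable_exp_mul hδ hzδ.le), boundaryTerm,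
    ← VectorMeasure.integral_fun_sub ((integrable_exp_mul hδ hzδ.le).smul_const _)
      (integrable_expConvolution hδ hu.isBC hzδ)]
  congr 1 with η
  rw [carlemanTransform_comp_add_right hz hu.isBC, expConvolution_eq, smul_sub]

end StieltjesFunctional

/-! ### The resolvent identity and the spectral inclusion. -/

section Spectrum

variable {X : Type*} [NormedAddCommGroup X] [NormedSpace ℂ X] [CompleteSpace X]
  {B : ℝ → X →L[ℂ] X} {hB : BoundedVariationOn B univ} {δ : ℝ}

/-- The transformed equation, written with a left inverse `R` of the characteristic operator
at `z₀`. -/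
theorem carlemanTransform_eq_of_leftInverse {A : X →ₗ.[ℂ] X}
    [IsFiniteMeasure hB.vectorMeasure.variation] (hδ : HasExpMoment hB δ) {f u : ℝ → X}
    (hf : IsBC f) (hu : IsMildSolution A hB f u) {z₀ : ℂ} {R : X →L[ℂ] X}
    (hR : ∀ x : (charOperator A hB z₀).domain, R (charOperator A hB z₀ x) = x) {z : ℂ}
    (hz : z.re ≠ 0) (hzδ : |z.re| < δ) :
    carlemanTransform u z =
      R ((z₀ - z) • carlemanTransform u z + (charIntegral hB z - charIntegral hB z₀)
        (carlemanTransform u z) + (u 0 + carlemanTransform f z - boundaryTerm hB u z)) := by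
  obtain ⟨hu, hmild⟩ := hu
  have hw := (isBC_functionalTerm (hB := hB) hu).add hf
  set T : X →L[ℂ] X := z₀ • ContinuousLinearMap.id ℂ X - charIntegral hB z₀ with hT
  have hU (t : ℝ) : ∫ s in (0 : ℝ)..t, u s = R (T (∫ s in (0 : ℝ)..t, u s)) -
      R (u t - u 0 - ∫ s in (0 : ℝ)..t, (functionalTerm hB u s + f s)) := by
    obtain ⟨h, heq⟩ := hmild t
    rw [heq, add_sub_cancel_right, ← map_sub]
    exact (hR ⟨_, h⟩).symm
  have hiU := integrable_carlemanKernel_smul_primitive hz hu.isBC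
  have hiu := integrable_carlemanKernel_smul_of_bounded hz hu.isBC
  have hic := integrable_carlemanKernel_smul_of_bounded hz (isBC_const (u 0))
  have hiw := integrable_carlemanKernel_smul_primitive hz hw
  have hV : carlemanTransform (fun t => ∫ s in (0 : ℝ)..t, u s) z =
      R (T (carlemanTransform (fun t => ∫ s in (0 : ℝ)..t, u s) z)) -
      R (carlemanTransform u z - carlemanTransform (fun _ => u 0) z -
        carlemanTransform (fun t => ∫ s in (0 : ℝ)..t, (functionalTerm hB u s + f s)) z) := by
    simp only [carlemanTransform_eq_integral]
    have hic' : Integrable fun t => carlemanKernel z t • u t - carlemanKernel z t • u 0 :=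
      hiu.sub hic
    have hiw' : Integrable fun t => carlemanKernel z t • u t - carlemanKernel z t • u 0 -
        carlemanKernel z t • ∫ s in (0 : ℝ)..t, (functionalTerm hB u s + f s) := hic'.sub hiw
    rw [← integral_sub hiu hic, ← integral_sub hic' hiw,
      ← T.integral_comp_comm hiU, ← R.integral_comp_comm (T.integrable_comp hiU),
      ← R.integral_comp_comm hiw',
      ← integral_sub (R.integrable_comp (T.integrable_comp hiU)) (R.integrable_comp hiw')]
    refine integral_congr_ae (ae_of_all _ fun t => ?_)
    simp only [map_smul, ← smul_sub]
    exact congrArg _ (hU t)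
  have hsum : carlemanTransform (fun t => functionalTerm hB u t + f t) z =
      charIntegral hB z (carlemanTransform u z) - boundaryTerm hB u z +
        carlemanTransform f z := by
    rw [← carlemanTransform_functionalTerm_eq_sub hδ hu hz hzδ]
    simp only [carlemanTransform_eq_integral, smul_add]
    exact integral_add (integrable_carlemanKernel_smul_of_bounded hz (isBC_functionalTerm hu))
      (integrable_carlemanKernel_smul_of_bounded hz hf)
  -- Multiplication by z turns transforms of primitives into transforms of the functions, and that
  -- of the constant into u(0).
  have h := congrArg (z • ·) hV
  simp only [smul_sub, ← map_smul, carlemanTransform_primitive hz hu.isBC,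
    carlemanTransform_primitive hz hw, carlemanTransform_const hz, hsum] at h
  rw [← map_sub] at h
  refine h.trans (congrArg R ?_)
  simp only [hT, sub_apply, smul_apply, ContinuousLinearMap.id_apply]
  module

theorem sp_subset (A : X →ₗ.[ℂ] X) (hδ0 : 0 < δ) (hδ : HasExpMoment hB δ) {f u : ℝ → X}
    (hf : IsBC f) (hu : IsMildSolution A hB f u) :
    sp u ⊆ imagCharSet A hB δ ∪ sp f := by
  have := hδ.isFiniteMeasure hδ0
  intro ξ hξ
  by_contra hnot
  rw [mem_union, not_or] at hnot
  obtain ⟨hξA, hξf⟩ := hnot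
  set z₀ : ℂ := Complex.I * (ξ : ℂ) with hz₀
  have hz₀δ : |z₀.re| < δ := by simpa [hz₀] using hδ0
  -- A left inverse suffices: û already exists off the axis and only has to be solved for.
  obtain ⟨R, -, hR⟩ : HasBoundedInverse (charOperator A hB z₀) := by
    by_contra h
    exact hξA ⟨hz₀δ, h⟩
  obtain ⟨V, hV, hz₀V, h, hh, hhf⟩ := not_not.1 hξf
  set S : Set ℂ := {z | |z.re| < δ} with hS
  set M : ℂ → X →L[ℂ] X := fun z =>
    R * ((z₀ - z) • (1 : X →L[ℂ] X) + (charIntegral hB z - charIntegral hB z₀)) with hM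
  have hMdiff : DifferentiableOn ℂ M S := by
    have h1 := differentiableOn_charIntegral hδ
    refine DifferentiableOn.const_mul (DifferentiableOn.add ?_ (h1.sub_const _)) R
    exact Differentiable.differentiableOn (by fun_prop)
  have hM0 : M z₀ = 0 := by simp [hM]
  -- On W the Neumann series inverts 1 - M(z), while f̂ has its extension h.
  set W : Set ℂ := V ∩ (S ∩ M ⁻¹' Metric.ball 0 1) with hW
  have hWopen : IsOpen W :=
    hV.inter (hMdiff.continuousOn.isOpen_inter_preimage (isOpen_strip δ) Metric.isOpen_ball)
  have hunit {z : ℂ} (hz : z ∈ W) : IsUnit (1 - M z) :=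
    isUnit_one_sub_of_norm_lt_one (by simpa using hz.2.2)
  refine hξ ⟨W, hWopen, ⟨hz₀V, hz₀δ, show M z₀ ∈ Metric.ball 0 1 by simp [hM0]⟩,
    fun z => Ring.inverse (1 - M z) (R (u 0 + h z - boundaryTerm hB u z)), ?_, ?_⟩
  · refine DifferentiableOn.analyticOnNhd ?_ hWopen
    refine DifferentiableOn.clm_apply ?_ ?_
    · intro z hz
      have hMz : DifferentiableAt ℂ (fun z => 1 - M z) z :=
        ((hMdiff z hz.2.1).differentiableAt ((isOpen_strip δ).mem_nhds hz.2.1)).const_sub 1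
      exact ((differentiableAt_inverse (hunit hz)).comp z hMz).differentiableWithinAt
    · refine R.differentiable.comp_differentiableOn (DifferentiableOn.sub ?_ ?_)
      · exact (hh.differentiableOn.mono inter_subset_left).const_add _
      · exact (differentiableOn_boundaryTerm hδ hu.1.isBC).mono fun z hz => hz.2.1
  · intro z hz hzre
    have key := carlemanTransform_eq_of_leftInverse hδ hf hu hR hzre hz.2.1
    have h1 : (1 - M z) (carlemanTransform u z) = R (u 0 + h z - boundaryTerm hB u z) := by
      rw [sub_apply, one_apply_eq_self, sub_eq_iff_eq_add, hhf z hz.1 hzre]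
      conv_lhs => rw [key]
      rw [map_add, add_comm]
      rfl
    beta_reduce
    rw [← h1, ← mul_apply_eq_comp, Ring.inverse_mul_cancel _ (hunit hz),
      one_apply_eq_self]

end Spectrum

end FunctionalDE

end

theorem proposition31 {X : Type*} [NormedAddCommGroup X] [NormedSpace ℂ X] [CompleteSpace X]
    (A : X →ₗ.[ℂ] X) (hA : A.IsClosed)
    {B : ℝ → X →L[ℂ] X} (hB : BoundedVariationOn B Set.univ)
    {δ : ℝ} (hδ : 0 < δ) (hBδ : FunctionalDE.HasExpMoment hB δ)
    {f : ℝ → X} (hf : FunctionalDE.IsBC f)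
    {u : ℝ → X} (hu : FunctionalDE.IsMildSolution A hB f u) :
    FunctionalDE.sp u ⊆ FunctionalDE.imagCharSet A hB δ ∪ FunctionalDE.sp f :=
  FunctionalDE.sp_subset A hδ hBδ hf hu
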